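/- For real polynomials $f,g\in\mathbb{R}[x]$ let $$f\Diamond g=\sum_{n\ge 0}\frac{f^{(n)}(x)}{n!}\,\frac{g^{(n)}(x)}{n!}\,x^n(x+1)^n .$$ For $I\subseteq\mathbb{R}$, a nonzero real polynomial is called $I$-rooted if all its complex zeros are real and lie in $I$, and real-rooted if it is $\mathbb{R}$-rooted (nonzero constants are $I$-rooted for every $I$); a nonzero polynomial is simple-rooted if all its complex zeros are simple. For real-rooted $f$ and $g$ with $\deg f=\deg g+1=d$, let $\alpha_1\le\cdots\le\alpha_d$ and $\beta_1\le\cdots\le\beta_{d-1}$ be the zeros of $f$ and $g$, respectively, counted with multiplicity. Write $g\preceq f$ if $$\alpha_1\le\beta_1\le\alpha_2\le\cdots\le\beta_{d-1}\le\alpha_d ,$$ and write $g\prec f$ if all these inequalities are strict. **Theorem.** Let $h$ be $[-1,0]$-rooted and let $f$ be real-rooted. (a) Then $f\Diamond h$ is real-rooted, and for every real polynomial $g$ with $g\preceq f$ we have $g\Diamond h\preceq f\Diamond h$. (b) If, moreover, $h$ is $(-1,0)$-rooted and simple-rooted and $f$ is simple-rooted, then $f\Diamond h$ is simple-rooted,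 and $g\Diamond h\prec f\Diamond h$ for every real polynomial $g$ with $g\prec f$. -/

import Mathlib

open Polynomial

/-- `f` is `I`-rooted: it is a nonzero real polynomial all of whose complex zeros are
real numbers lying in `I`.  Nonzero constants are `I`-rooted for every `I`. -/
def RootedIn (I : Set ℝ) (f : ℝ[X]) : Prop :=
  f ≠ 0 ∧ ∀ z : ℂ, aeval z f = 0 → ∃ x ∈ I, (x : ℂ) = z

/-- `f` is a nonzero real polynomial all of whose complex zeros are real. -/
def RealRooted (f : ℝ[X]) : Prop := RootedIn Set.univ f

/-- Every (complex) zero of `f` is a simple zero. -/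
def SimpleRooted (f : ℝ[X]) : Prop :=
  ∀ z : ℂ, aeval z f = 0 → aeval z (derivative f) ≠ 0

/-- `g ⪯ f`: both are real-rooted, `deg f = deg g + 1`, and the zeros `α` of `f` and `β` of `g`,
listed with multiplicity in weakly increasing order, satisfy `α₁ ≤ β₁ ≤ α₂ ≤ ⋯ ≤ β_{d-1} ≤ α_d`. -/
def Interlaces (g f : ℝ[X]) : Prop :=
  RealRooted g ∧ RealRooted f ∧ f.natDegree = g.natDegree + 1 ∧
    ∃ (α : Fin (g.natDegree + 1) → ℝ) (β : Fin g.natDegree → ℝ),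
      Monotone α ∧ Monotone β ∧
      f.roots = Finset.univ.val.map α ∧ g.roots = Finset.univ.val.map β ∧
      ∀ i : Fin g.natDegree, α i.castSucc ≤ β i ∧ β i ≤ α i.succ

/-- `g ≺ f`: as `g ⪯ f`, with all the inequalities strict. -/
def StrictlyInterlaces (g f : ℝ[X]) : Prop :=
  RealRooted g ∧ RealRooted f ∧ f.natDegree = g.natDegree + 1 ∧
    ∃ (α : Fin (g.natDegree + 1) → ℝ) (β : Fin g.natDegree → ℝ),
      Monotone α ∧ Monotone β ∧
      f.roots = Finset.univ.val.map α ∧ g.roots = Finset.univ.val.map β ∧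
      ∀ i : Fin g.natDegree, α i.castSucc < β i ∧ β i < α i.succ

/-- The diamond product `∑_{n ≥ 0} (f⁽ⁿ⁾ / n!) (g⁽ⁿ⁾ / n!) xⁿ (x+1)ⁿ`.
The terms with `n > deg f` vanish, see `diamond_eq_finsum`. -/
noncomputable def diamond (f g : ℝ[X]) : ℝ[X] :=
  ∑ n ∈ Finset.range (f.natDegree + 1),
    (C ((n.factorial : ℝ)⁻¹) * derivative^[n] f) *
      (C ((n.factorial : ℝ)⁻¹) * derivative^[n] g) * X ^ n * (X + 1) ^ n

theorem diamond_eq_finsum (f g : ℝ[X]) :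
    diamond f g = ∑ᶠ n : ℕ, (C ((n.factorial : ℝ)⁻¹) * derivative^[n] f) *
      (C ((n.factorial : ℝ)⁻¹) * derivative^[n] g) * X ^ n * (X + 1) ^ n := by
  unfold diamond
  symm
  apply finsum_eq_sum_of_support_subset
  intro n hn
  by_contra h
  apply hn
  have h' : f.natDegree < n := by simpa using h
  simp [iterate_derivative_eq_zero h']

infixl:70 " ◇ " => diamond
infix:50 " ⪯ᵢ " => Interlaces
infix:50 " ≺ᵢ " => StrictlyInterlaces

/-! By Taylor expansion, (F ◇ H)(x) is the coefficient of t^m, m = deg H, in F(x+t) · Q(t) with Q(t)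
= t^m H(x + x(x+1)/t). A nonzero root of Q is t = x(x+1)/(θ-x) with θ a zero of H; for θ in [-1,0]
and Im x ≥ 0 it satisfies Im t ≤ 0. If the zeros of F lie strictly below x, then F(x+t) has its
zeros in the open lower half-plane, so the product has at most m real zeros and none above the real
axis. Gauss–Lucas then makes its m-th coefficient nonzero (`coeff_ne_zero_of_im_roots_nonpos`,
`diamondValue_ne_zero`). This gives real-rootedness.

For interlacing, g ⪯ f amounts to Im(f · conj g) > 0 on the upper half-plane after normalising signs
(Hermite–Biehler), which makes f + w g zero-free there whenever Im w ≥ 0. Since ◇ is linear in its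
first factor, nonvanishing for complex F carries this condition over (`crossIm_diamond_pos`);
following arguments down to the real axis recovers the interlacing (`interlacing_of_sin_pos`).

In the strict case f + i g has all its zeros in the open lower half-plane, so the nonvanishing
extends to real x and excludes common zeros of f ◇ h and g ◇ h. -/

/-! ### Gauss–Lucas and coefficients. -/

/-- In p'/p = ∑ 1/(z - a) no term has positive imaginary part, and the term of `a₀` has a negative
one. -/
theorem derivative_eval_ne_zero_of_im_roots_le {p : ℂ[X]} {z a₀ : ℂ}
    (hz : p.eval z ≠ 0) (hp : ∀ a ∈ p.roots, a.im ≤ z.im) (h₀ : a₀ ∈ p.roots)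
    (h₀z : a₀.im < z.im) : p.derivative.eval z ≠ 0 := by
  rw [(IsAlgClosed.splits p).eval_derivative_eq_eval_mul_sum hz]
  refine mul_ne_zero hz fun hsum => ?_
  obtain ⟨s, hs⟩ := Multiset.exists_cons_of_mem h₀
  have him : ∀ a : ℂ, a.im ≤ z.im → (1 / (z - a)).im ≤ 0 := fun a ha => by
    rw [one_div, Complex.inv_im]
    exact div_nonpos_of_nonpos_of_nonneg (by simp [ha]) (Complex.normSq_nonneg _)
  have hlt : (1 / (z - a₀)).im < 0 := by
    rw [one_div, Complex.inv_im]
    refine div_neg_of_neg_of_pos (by simp [h₀z]) (Complex.normSq_pos.2 (sub_ne_zero.2 ?_))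
    rintro rfl
    exact lt_irrefl _ h₀z
  have hs' : ((s.map fun a => 1 / (z - a)).sum).im ≤ 0 := by
    have : ∀ t : Multiset ℂ, (∀ a ∈ t, a.im ≤ z.im) →
        ((t.map fun a => 1 / (z - a)).sum).im ≤ 0 := fun t => by
      induction t using Multiset.induction_on with
      | empty => simp
      | cons a t ih =>
        intro ht
        rw [Multiset.map_cons, Multiset.sum_cons, Complex.add_im]
        exact add_nonpos (him a (ht a (Multiset.mem_cons_self a t)))
          (ih fun b hb => ht b (Multiset.mem_cons_of_mem hb))
    exact this s fun a ha => hp a (hs ▸ Multiset.mem_cons_of_mem ha)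
  rw [hs, Multiset.map_cons, Multiset.sum_cons] at hsum
  have := congrArg Complex.im hsum
  rw [Complex.add_im, Complex.zero_im] at this
  linarith

/-- A coefficient of a polynomial with zeros in the closed lower half-plane is nonzero as soon as
its index is at least the number of real zeros. -/
theorem coeff_ne_zero_of_im_roots_nonpos (k : ℕ) {p : ℂ[X]}
    (hp : ∀ a ∈ p.roots, a.im ≤ 0) (hcard : (p.roots.filter fun a => a.im = 0).card ≤ k)
    (hk : k ≤ p.natDegree) (hp0 : p ≠ 0) : p.coeff k ≠ 0 := by
  induction k generalizing p with
  | zero =>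
    rw [coeff_zero_eq_eval_zero]
    intro h0
    have hmem : (0 : ℂ) ∈ p.roots.filter fun a => a.im = 0 := by
      simp [hp0, h0]
    have := Multiset.card_pos_iff_exists_mem.2 ⟨_, hmem⟩
    omega
  | succ k ih =>
    have hsplit := (IsAlgClosed.splits p).natDegree_eq_card_roots
    by_cases hall : ∀ a ∈ p.roots, a.im = 0
    · rw [Multiset.filter_eq_self.2 hall, ← hsplit] at hcard
      rw [le_antisymm hk hcard]
      exact leadingCoeff_ne_zero.2 hp0
    push Not at hall
    obtain ⟨a₀, ha₀, ha₀'⟩ := hall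
    have hlt : a₀.im < 0 := lt_of_le_of_ne (hp a₀ ha₀) ha₀'
    have hd0 : derivative p ≠ 0 := fun h => by
      have := derivative_eq_zero.1 h
      omega
    have hroot : ∀ z, 0 ≤ z.im → (derivative p).eval z = 0 → p.eval z = 0 := fun z hz hdz => by
      by_contra hne
      exact derivative_eval_ne_zero_of_im_roots_le hne (fun a ha => (hp a ha).trans hz) ha₀
        (hlt.trans_le hz) hdz
    have hcoeff := ih (p := derivative p) ?_ ?_ ?_ hd0
    · rw [coeff_derivative] at hcoeff
      exact left_ne_zero_of_mul hcoeff
    · intro z hz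
      by_contra! hpos
      have h1 := hroot z hpos.le ((mem_roots hd0).1 hz)
      have := hp z ((mem_roots hp0).2 h1)
      linarith
    -- Differentiation lowers each real multiplicity by one and creates no new real zero, so the
    -- number of real zeros drops unless it is already 0.
    · have hcount : ∀ z : ℂ, z.im = 0 →
          (derivative p).roots.count z = p.roots.count z - 1 := fun z hz => by
        rw [count_roots, count_roots]
        by_cases h1 : p.IsRoot z
        · exact derivative_rootMultiplicity_of_root h1
        · rw [rootMultiplicity_eq_zero h1,
            rootMultiplicity_eq_zero fun h2 => h1 (hroot z hz.ge h2)]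
      have hle : ((derivative p).roots.filter fun a => a.im = 0) ≤
          p.roots.filter fun a => a.im = 0 := by
        rw [Multiset.le_iff_count]
        intro z
        rw [Multiset.count_filter, Multiset.count_filter]
        split_ifs with hz
        · rw [hcount z hz]; omega
        · exact le_rfl
      by_cases hemp : (p.roots.filter fun a => a.im = 0) = 0
      · rw [hemp] at hle
        rw [Multiset.le_zero.1 hle]
        simp
      · obtain ⟨y, hy⟩ := Multiset.exists_mem_of_ne_zero hemp
        have hylt : ((derivative p).roots.filter fun a => a.im = 0) <
            p.roots.filter fun a => a.im = 0 := by
          refine lt_of_le_of_ne hle fun heq => ?_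
          have h1 := congrArg (Multiset.count y) heq
          have hy' := (Multiset.mem_filter.1 hy)
          rw [Multiset.count_filter_of_pos (p := fun a : ℂ => a.im = 0) hy'.2,
            Multiset.count_filter_of_pos (p := fun a : ℂ => a.im = 0) hy'.2, hcount y hy'.2] at h1
          have := Multiset.count_pos.2 hy'.1
          omega
        have := Multiset.card_lt_card hylt
        omega
    · rw [natDegree_derivative]
      omega

/-! ### Pointwise form, degree and leading sign of the diamond product. -/

/-- The value at `x` of the diamond product of `F` and `H`. -/
noncomputable def diamondValue (F H : ℂ[X]) (x : ℂ) : ℂ :=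
  ∑ n ∈ Finset.range (H.natDegree + 1),
    (hasseDeriv n F).eval x * (hasseDeriv n H).eval x * (x * (x + 1)) ^ n

/-- The summation range depends on `H` alone, so linearity in `F` needs no degree bookkeeping. -/
theorem diamondValue_add (F G H : ℂ[X]) (x : ℂ) :
    diamondValue (F + G) H x = diamondValue F H x + diamondValue G H x := by
  simp only [diamondValue, map_add, eval_add, add_mul, Finset.sum_add_distrib]

theorem diamondValue_C_mul (c : ℂ) (F H : ℂ[X]) (x : ℂ) :
    diamondValue (C c * F) H x = c * diamondValue F H x := by
  simp only [diamondValue, ← smul_eq_C_mul, map_smul, eval_smul, smul_eq_mul, Finset.mul_sum,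
    mul_assoc]

theorem C_inv_factorial_mul_iterate_derivative (n : ℕ) (f : ℝ[X]) :
    C ((n.factorial : ℝ)⁻¹) * derivative^[n] f = hasseDeriv n f := by
  rw [← factorial_smul_hasseDeriv, LinearMap.smul_apply, nsmul_eq_mul, ← C_eq_natCast,
    ← mul_assoc, ← C_mul, inv_mul_cancel₀ (by positivity), C_1, one_mul]

theorem diamond_eq_sum_hasseDeriv (f h : ℝ[X]) : diamond f h =
    ∑ n ∈ Finset.range (f.natDegree + 1),
      hasseDeriv n f * hasseDeriv n h * X ^ n * (X + 1) ^ n := by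
  simp only [diamond, C_inv_factorial_mul_iterate_derivative]

theorem hasseDeriv_map_complex (n : ℕ) (f : ℝ[X]) :
    hasseDeriv n (f.map (algebraMap ℝ ℂ)) = (hasseDeriv n f).map (algebraMap ℝ ℂ) := by
  ext i
  simp [hasseDeriv_coeff]

theorem aeval_diamond (f h : ℝ[X]) (x : ℂ) : aeval x (diamond f h) =
    diamondValue (f.map (algebraMap ℝ ℂ)) (h.map (algebraMap ℝ ℂ)) x := by
  have key : ∀ n, aeval x (hasseDeriv n f * hasseDeriv n h * X ^ n * (X + 1) ^ n) =
      (hasseDeriv n (f.map (algebraMap ℝ ℂ))).eval x *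
        (hasseDeriv n (h.map (algebraMap ℝ ℂ))).eval x * (x * (x + 1)) ^ n := fun n => by
    simp only [hasseDeriv_map_complex, eval_map_algebraMap, map_mul, map_pow, map_add, aeval_X,
      map_one, mul_pow, mul_assoc]
  rw [diamond_eq_sum_hasseDeriv, map_sum, diamondValue, natDegree_map]
  simp only [key]
  have hM : ∀ N, min f.natDegree h.natDegree ≤ N → ∑ n ∈ Finset.range (N + 1),
      (hasseDeriv n (f.map (algebraMap ℝ ℂ))).eval x *
        (hasseDeriv n (h.map (algebraMap ℝ ℂ))).eval x * (x * (x + 1)) ^ n =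
      ∑ n ∈ Finset.range (min f.natDegree h.natDegree + 1),
      (hasseDeriv n (f.map (algebraMap ℝ ℂ))).eval x *
        (hasseDeriv n (h.map (algebraMap ℝ ℂ))).eval x * (x * (x + 1)) ^ n := fun N hN => by
    symm
    refine Finset.sum_subset (Finset.range_mono (by omega)) fun n _ hn => ?_
    have hn' : min f.natDegree h.natDegree < n := by
      rw [Finset.mem_range] at hn; omega
    rcases min_lt_iff.1 hn' with h1 | h1
    · rw [hasseDeriv_eq_zero_of_lt_natDegree _ _ (by simpa using h1)]; simp
    · rw [hasseDeriv_eq_zero_of_lt_natDegree (h.map _) _ (by simpa using h1)]; simp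
  rw [hM _ (min_le_left _ _), hM _ (min_le_right _ _)]

/-- The nonzero terms contribute positive multiples of the same product of leading coefficients, so
nothing cancels in top degree. -/
theorem natDegree_diamond_and_leadingCoeff_mul_pos (f h : ℝ[X]) (hf : f ≠ 0) (hh : h ≠ 0) :
    (diamond f h).natDegree = f.natDegree + h.natDegree ∧
      0 < (diamond f h).leadingCoeff * (f.leadingCoeff * h.leadingCoeff) := by
  have hterm : ∀ n ≤ f.natDegree, n ≤ h.natDegree →
      (hasseDeriv n f * hasseDeriv n h * X ^ n * (X + 1) ^ n).natDegree ≤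
        f.natDegree + h.natDegree ∧
      (hasseDeriv n f * hasseDeriv n h * X ^ n * (X + 1) ^ n).coeff (f.natDegree + h.natDegree) =
        (f.natDegree.choose n * h.natDegree.choose n : ℝ) *
          (f.leadingCoeff * h.leadingCoeff) := fun n hnf hnh => by
    have h1 : (hasseDeriv n f).natDegree ≤ f.natDegree - n := natDegree_hasseDeriv_le f n
    have h2 : (hasseDeriv n h).natDegree ≤ h.natDegree - n := natDegree_hasseDeriv_le h n
    have h3 : (X ^ n : ℝ[X]).natDegree ≤ n := natDegree_X_pow_le n
    have hm : (X + 1 : ℝ[X]).Monic := by simpa using monic_X_add_C (1 : ℝ)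
    have h4' : ((X + 1 : ℝ[X]) ^ n).natDegree = n := by
      rw [hm.natDegree_pow]
      have : (X + 1 : ℝ[X]).natDegree = 1 := by simpa using natDegree_X_add_C (1 : ℝ)
      simp [this]
    have h12 := natDegree_mul_le_of_le h1 h2
    have h123 := natDegree_mul_le_of_le h12 h3
    have h1234 := natDegree_mul_le_of_le h123 h4'.le
    have hdeg : f.natDegree - n + (h.natDegree - n) + n + n = f.natDegree + h.natDegree := by
      omega
    refine ⟨hdeg ▸ h1234, ?_⟩
    rw [← hdeg, coeff_mul_add_eq_of_natDegree_le h123 h4'.le, coeff_mul_add_eq_of_natDegree_le h12 h3,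
      coeff_mul_add_eq_of_natDegree_le h1 h2, hasseDeriv_coeff, hasseDeriv_coeff,
      Nat.sub_add_cancel hnf, Nat.sub_add_cancel hnh, coeff_X_pow_self]
    have := (hm.pow n).coeff_natDegree
    rw [h4'] at this
    rw [this]
    simp only [leadingCoeff]
    ring
  have hzero : ∀ n, h.natDegree < n →
      hasseDeriv n f * hasseDeriv n h * X ^ n * (X + 1) ^ n = 0 := fun n hn => by
    rw [hasseDeriv_eq_zero_of_lt_natDegree h _ hn]; simp
  have hle : (diamond f h).natDegree ≤ f.natDegree + h.natDegree := by
    rw [diamond_eq_sum_hasseDeriv]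
    refine natDegree_sum_le_of_forall_le _ _ fun n hn => ?_
    rcases le_or_gt n h.natDegree with h1 | h1
    · exact (hterm n (by simpa [Nat.lt_succ_iff] using hn) h1).1
    · rw [hzero n h1]; simp
  have hpos : 0 < (f.leadingCoeff * h.leadingCoeff) ^ 2 := by
    have := mul_ne_zero (leadingCoeff_ne_zero.2 hf) (leadingCoeff_ne_zero.2 hh)
    positivity
  have hcoeff : 0 < (diamond f h).coeff (f.natDegree + h.natDegree) *
      (f.leadingCoeff * h.leadingCoeff) := by
    rw [diamond_eq_sum_hasseDeriv, finsetSum_coeff, Finset.sum_mul]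
    refine Finset.sum_pos' (fun n hn => ?_) ⟨0, by simp, ?_⟩
    · rcases le_or_gt n h.natDegree with h1 | h1
      · rw [(hterm n (by simpa [Nat.lt_succ_iff] using hn) h1).2, mul_assoc, ← sq]
        positivity
      · rw [hzero n h1]; simp
    · rw [(hterm 0 (Nat.zero_le _) (Nat.zero_le _)).2, mul_assoc, ← sq]
      simpa using hpos
  have hdeg : (diamond f h).natDegree = f.natDegree + h.natDegree :=
    le_antisymm hle (le_natDegree_of_ne_zero (left_ne_zero_of_mul hcoeff.ne'))
  refine ⟨hdeg, ?_⟩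
  rwa [← hdeg] at hcoeff

/-! ### Nonvanishing of the diamond product. -/

/-- `t ^ deg H * H (x + x (x + 1) / t)` as a polynomial in `t`. -/
noncomputable def reflectedTaylor (H : ℂ[X]) (x : ℂ) : ℂ[X] :=
  reflect H.natDegree ((taylor x H).comp (C (x * (x + 1)) * X))

theorem coeff_reflectedTaylor (H : ℂ[X]) (x : ℂ) {i j : ℕ} (hij : i + j = H.natDegree) :
    (reflectedTaylor H x).coeff j = (hasseDeriv i H).eval x * (x * (x + 1)) ^ i := by
  rw [reflectedTaylor, coeff_reflect, revAt_le (by omega), comp_C_mul_X_coeff, taylor_coeff,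
    ← hij, Nat.add_sub_cancel]

theorem natDegree_taylor_comp_C_mul_X_le (H : ℂ[X]) (x c : ℂ) :
    ((taylor x H).comp (C c * X)).natDegree ≤ H.natDegree := by
  refine natDegree_comp_le.trans ?_
  rw [natDegree_taylor]
  exact (Nat.mul_le_mul_left _ ((natDegree_C_mul_le c X).trans natDegree_X_le)).trans (mul_one _).le

theorem natDegree_reflectedTaylor_le (H : ℂ[X]) (x : ℂ) :
    (reflectedTaylor H x).natDegree ≤ H.natDegree := by
  refine (natDegree_reflect_le ..).trans (max_le le_rfl (natDegree_taylor_comp_C_mul_X_le ..))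

theorem eval_reflectedTaylor (H : ℂ[X]) (x : ℂ) {t : ℂ} (ht : t ≠ 0) :
    (reflectedTaylor H x).eval t = t ^ H.natDegree * H.eval (x + x * (x + 1) / t) := by
  let inv : Invertible t⁻¹ := invertibleOfNonzero (inv_ne_zero ht)
  have h := eval₂_reflect_mul_pow (RingHom.id ℂ) t⁻¹ H.natDegree _
    (natDegree_taylor_comp_C_mul_X_le H x (x * (x + 1)))
  rw [invOf_eq_inv, inv_inv, eval₂_id, eval₂_id, eval_comp, taylor_eval] at h
  rw [reflectedTaylor, add_comm x (_ / t), div_eq_mul_inv]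
  simp only [eval_mul, eval_C, eval_X] at h
  rw [← h, mul_left_comm, ← mul_pow, mul_inv_cancel₀ ht, one_pow, mul_one]

theorem diamondValue_eq_coeff (F H : ℂ[X]) (x : ℂ) :
    diamondValue F H x = (taylor x F * reflectedTaylor H x).coeff H.natDegree := by
  rw [coeff_mul, Finset.Nat.sum_antidiagonal_eq_sum_range_succ
    (fun i j => (taylor x F).coeff i * (reflectedTaylor H x).coeff j), diamondValue]
  refine Finset.sum_congr rfl fun n hn => ?_
  rw [coeff_reflectedTaylor H x (i := n) (by rw [Finset.mem_range] at hn; omega), taylor_coeff,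
    mul_assoc]

theorem im_roots_reflectedTaylor_nonpos {H : ℂ[X]} {x t : ℂ} (hx : 0 ≤ x.im)
    (hH : ∀ a ∈ H.roots, ∃ θ ∈ Set.Icc (-1 : ℝ) 0, (θ : ℂ) = a)
    (hxH : H.eval x ≠ 0 ∨ x * (x + 1) ≠ 0) (hH0 : H ≠ 0)
    (ht : (reflectedTaylor H x).eval t = 0) : t.im ≤ 0 := by
  by_cases ht0 : t = 0
  · simp [ht0]
  rw [eval_reflectedTaylor H x ht0] at ht
  have hroot := (mul_eq_zero.1 ht).resolve_left (pow_ne_zero _ ht0)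
  obtain ⟨θ, ⟨h1, h2⟩, hθ⟩ := hH _ ((mem_roots hH0).2 hroot)
  have heq : t * (θ - x) = x * (x + 1) := by
    rw [hθ]; field_simp; ring
  have hxθ : x - θ ≠ 0 := by
    intro h0
    have hx' : x = θ := sub_eq_zero.1 h0
    rw [← hx', sub_self, mul_zero] at heq
    rcases hxH with h | h
    · rw [← hθ, ← hx'] at hroot
      exact h hroot
    · exact h heq.symm
  -- Division of x(x+1) by x - θ leaves remainder θ(1+θ), which is nonpositive exactly for θ in
  -- [-1,0].
  have ht' : t = -(x + 1 + θ) + ((-(θ * (1 + θ)) : ℝ) : ℂ) * (x - θ)⁻¹ := by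
    field_simp
    push_cast
    linear_combination -heq
  rw [ht', Complex.add_im, Complex.im_ofReal_mul, Complex.inv_im]
  have h3 : 0 ≤ x.im / Complex.normSq (x - θ) := div_nonneg hx (Complex.normSq_nonneg _)
  have h4 : 0 ≤ -(θ * (1 + θ)) := by nlinarith
  have h5 := mul_nonneg h4 h3
  simp only [Complex.neg_im, Complex.add_im, Complex.sub_im, Complex.ofReal_im, Complex.one_im,
    neg_div, sub_zero, add_zero, mul_neg]
  linarith

/-- The condition `hxH` keeps the degree of the product at least deg H: the second factor has degree
deg H if H(x) ≠ 0, and otherwise at least deg H - 1, the missing unit coming from `F`. -/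
theorem diamondValue_ne_zero {F H : ℂ[X]} {x : ℂ} (hx : 0 ≤ x.im) (hF0 : F ≠ 0)
    (hF : ∀ a ∈ F.roots, a.im < x.im) (hH0 : H ≠ 0)
    (hH : ∀ a ∈ H.roots, ∃ θ ∈ Set.Icc (-1 : ℝ) 0, (θ : ℂ) = a)
    (hxH : H.eval x ≠ 0 ∨ 0 < F.natDegree ∧ (derivative H).eval x * (x * (x + 1)) ≠ 0) :
    diamondValue F H x ≠ 0 := by
  have hP0 : taylor x F ≠ 0 := by simpa using hF0
  have hQdeg : (reflectedTaylor H x) ≠ 0 ∧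
      H.natDegree ≤ F.natDegree + (reflectedTaylor H x).natDegree := by
    rcases hxH with h | ⟨h1, h2⟩
    · have hc : (reflectedTaylor H x).coeff H.natDegree ≠ 0 := by
        rw [coeff_reflectedTaylor H x (zero_add _)]
        simpa using h
      have := le_natDegree_of_ne_zero hc
      exact ⟨fun h0 => hc (by rw [h0, coeff_zero]), by omega⟩
    · have hH1 : H.natDegree ≠ 0 := fun h0 => by
        rw [derivative_eq_zero.2 h0] at h2
        simp at h2
      have hc : (reflectedTaylor H x).coeff (H.natDegree - 1) ≠ 0 := by
        rw [coeff_reflectedTaylor H x (i := 1) (by omega)]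
        simpa using h2
      have := le_natDegree_of_ne_zero hc
      exact ⟨fun h0 => hc (by rw [h0, coeff_zero]), by omega⟩
  have hPQ : taylor x F * reflectedTaylor H x ≠ 0 := mul_ne_zero hP0 hQdeg.1
  have hP : ∀ t ∈ (taylor x F).roots, t.im < 0 := fun t ht => by
    have h1 := (mem_roots hP0).1 ht
    rw [IsRoot.def, taylor_eval] at h1
    have := hF _ ((mem_roots hF0).2 h1)
    rw [Complex.add_im] at this
    linarith
  rw [diamondValue_eq_coeff]
  refine coeff_ne_zero_of_im_roots_nonpos _ ?_ ?_ ?_ hPQ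
  · intro t ht
    rw [roots_mul hPQ, Multiset.mem_add] at ht
    rcases ht with ht | ht
    · exact (hP t ht).le
    · exact im_roots_reflectedTaylor_nonpos hx hH (hxH.imp id fun h => right_ne_zero_of_mul h.2)
        hH0 ((mem_roots hQdeg.1).1 ht)
  · rw [roots_mul hPQ, Multiset.filter_add,
      Multiset.filter_eq_nil.2 fun t ht => (hP t ht).ne, zero_add]
    exact ((Multiset.card_le_card (Multiset.filter_le _ _)).trans (card_roots' _)).trans
      (natDegree_reflectedTaylor_le H x)
  · rw [natDegree_mul hP0 hQdeg.1, natDegree_taylor]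
    exact hQdeg.2

/-! ### Interlacing in terms of arguments on the upper half-plane. -/

/-- The argument of `c + i`, as a function of the real number `c`. -/
noncomputable def argAddI (c : ℝ) : ℝ := Real.pi / 2 - Real.arctan c

theorem argAddI_pos (c : ℝ) : 0 < argAddI c := sub_pos.2 (Real.arctan_lt_pi_div_two c)

theorem argAddI_lt_pi (c : ℝ) : argAddI c < Real.pi := by
  have := Real.neg_pi_div_two_lt_arctan c
  unfold argAddI
  linarith

theorem argAddI_antitone : Antitone argAddI := fun _ _ h =>
  sub_le_sub_left (Real.arctan_strictMono.monotone h) _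

theorem add_I_eq_mul_exp (c : ℝ) :
    (c + Complex.I : ℂ) = (√(1 + c ^ 2) : ℝ) * Complex.exp (argAddI c * Complex.I) := by
  have h : √(1 + c ^ 2) ≠ 0 := by positivity
  rw [Complex.exp_mul_I, ← Complex.ofReal_cos, ← Complex.ofReal_sin, argAddI,
    Real.cos_pi_div_two_sub, Real.sin_pi_div_two_sub, Real.sin_arctan, Real.cos_arctan]
  have h' : ((√(1 + c ^ 2) : ℝ) : ℂ) ≠ 0 := by exact_mod_cast h
  push_cast
  field_simp

/-- The sum of the arguments of `t + y i - a` over the real zeros `a` of `f`. -/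
noncomputable def rootPhase (f : ℝ[X]) (t y : ℝ) : ℝ :=
  (f.roots.map fun a => argAddI ((t - a) / y)).sum

theorem exists_prod_eq_mul_exp (s : Multiset ℝ) (t : ℝ) {y : ℝ} (hy : 0 < y) :
    ∃ R : ℝ, 0 < R ∧ (s.map fun a : ℝ => (t + y * Complex.I - a : ℂ)).prod =
      R * Complex.exp ((s.map fun a => argAddI ((t - a) / y)).sum * Complex.I) := by
  induction s using Multiset.induction_on with
  | empty => exact ⟨1, one_pos, by simp⟩
  | cons a s ih =>
    obtain ⟨R, hR, h⟩ := ih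
    refine ⟨y * √(1 + ((t - a) / y) ^ 2) * R, by positivity, ?_⟩
    have hy' : (y : ℂ) ≠ 0 := by exact_mod_cast hy.ne'
    have h1 : (t + y * Complex.I - a : ℂ) = y * (((t - a) / y : ℝ) + Complex.I) := by
      push_cast
      field_simp
      ring
    rw [Multiset.map_cons, Multiset.prod_cons, h, h1, add_I_eq_mul_exp, Multiset.map_cons,
      Multiset.sum_cons]
    push_cast
    rw [add_mul, Complex.exp_add]
    ring

theorem exists_leadingCoeff_mul_aeval_eq {f : ℝ[X]} (hf : f.Splits) (hf0 : f ≠ 0) (t : ℝ)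
    {y : ℝ} (hy : 0 < y) : ∃ R : ℝ, 0 < R ∧
      (f.leadingCoeff : ℂ) * aeval (t + y * Complex.I : ℂ) f =
        R * Complex.exp (rootPhase f t y * Complex.I) := by
  obtain ⟨R, hR, h⟩ := exists_prod_eq_mul_exp f.roots t hy
  have hl := leadingCoeff_ne_zero.2 hf0
  refine ⟨f.leadingCoeff ^ 2 * R, by positivity, ?_⟩
  conv_lhs => rw [hf.eq_prod_roots]
  rw [map_mul, aeval_C, map_multiset_prod, Multiset.map_map]
  have : (f.roots.map ((aeval (t + y * Complex.I : ℂ)) ∘ fun a => X - C a)) =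
      f.roots.map fun a : ℝ => (t + y * Complex.I - a : ℂ) :=
    Multiset.map_congr rfl fun a _ => by simp
  rw [this, h, leadingCoeff_mul, rootPhase]
  have hm : (f.roots.map fun a => X - C a).prod.leadingCoeff = 1 :=
    monic_multiset_prod_of_monic _ _ fun a _ => monic_X_sub_C a
  rw [hm, leadingCoeff_C, Complex.coe_algebraMap]
  push_cast
  ring

/-- The imaginary part of `f * conj g` at `z`, after `f` and `g` are multiplied by their leading
coefficients. -/
noncomputable def crossIm (f g : ℝ[X]) (z : ℂ) : ℝ :=
  ((f.leadingCoeff * aeval z f) * (starRingEnd ℂ) (g.leadingCoeff * aeval z g)).im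

theorem crossIm_pos_iff {f g : ℝ[X]} (hf : f.Splits) (hf0 : f ≠ 0) (hg : g.Splits) (hg0 : g ≠ 0)
    (t : ℝ) {y : ℝ} (hy : 0 < y) : 0 < crossIm f g (t + y * Complex.I) ↔
      0 < Real.sin (rootPhase f t y - rootPhase g t y) := by
  obtain ⟨R, hR, h⟩ := exists_leadingCoeff_mul_aeval_eq hf hf0 t hy
  obtain ⟨S, hS, h'⟩ := exists_leadingCoeff_mul_aeval_eq hg hg0 t hy
  have key : crossIm f g (t + y * Complex.I) =
      (R * S) * Real.sin (rootPhase f t y - rootPhase g t y) := by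
    rw [crossIm, h, h', map_mul, Complex.conj_ofReal, ← Complex.exp_conj, map_mul,
      Complex.conj_ofReal, Complex.conj_I, mul_mul_mul_comm, ← Complex.exp_add,
      ← Complex.ofReal_mul, Complex.im_ofReal_mul, ← Complex.exp_ofReal_mul_I_im]
    push_cast
    ring_nf
  rw [key]
  exact ⟨fun h => pos_of_mul_pos_right h (by positivity), fun h => by positivity⟩

theorem rootPhase_eq_sum {n : ℕ} {f : ℝ[X]} {α : Fin n → ℝ}
    (hα : f.roots = Finset.univ.val.map α) (t y : ℝ) :
    rootPhase f t y = ∑ i, argAddI ((t - α i) / y) := by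
  rw [rootPhase, hα, Multiset.map_map]
  rfl

theorem argAddI_le_argAddI {a b : ℝ} (hab : a ≤ b) (t : ℝ) {y : ℝ} (hy : 0 < y) :
    argAddI ((t - a) / y) ≤ argAddI ((t - b) / y) :=
  argAddI_antitone (by gcongr)

/-- The argument of t + iy - a increases with a. Pairing each β with the α above it bounds the phase
difference below by the argument of the first α; pairing with the α below bounds it above by that of
the last. -/
theorem crossIm_pos_of_interlacing {n : ℕ} {f g : ℝ[X]} (hf : f.Splits) (hf0 : f ≠ 0)
    (hg : g.Splits) (hg0 : g ≠ 0) {α : Fin (n + 1) → ℝ} {β : Fin n → ℝ}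
    (hα : f.roots = Finset.univ.val.map α) (hβ : g.roots = Finset.univ.val.map β)
    (h : ∀ i, α i.castSucc ≤ β i ∧ β i ≤ α i.succ) {z : ℂ} (hz : 0 < z.im) :
    0 < crossIm f g z := by
  rw [← Complex.re_add_im z, crossIm_pos_iff hf hf0 hg hg0 _ hz, rootPhase_eq_sum hα,
    rootPhase_eq_sum hβ]
  apply Real.sin_pos_of_pos_of_lt_pi
  · rw [Fin.sum_univ_succ, add_sub_assoc, ← Finset.sum_sub_distrib]
    exact add_pos_of_pos_of_nonneg (argAddI_pos _) (Finset.sum_nonneg fun i _ =>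
      sub_nonneg.2 (argAddI_le_argAddI (h i).2 _ hz))
  · rw [Fin.sum_univ_castSucc, add_sub_right_comm, ← Finset.sum_sub_distrib]
    exact (add_le_of_nonpos_left (Finset.sum_nonpos fun i _ =>
      sub_nonpos.2 (argAddI_le_argAddI (h i).1 _ hz))).trans_lt (argAddI_lt_pi _)

open Filter Topology

theorem tendsto_argAddI_mul {c : ℝ} (hc : c ≠ 0) :
    Tendsto (fun s : ℝ => argAddI (c / s⁻¹)) atTop (𝓝 (if c < 0 then Real.pi else 0)) := by
  simp only [div_inv_eq_mul]
  rcases hc.lt_or_gt with h | h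
  · rw [if_pos h]
    have h1 : Tendsto (fun s : ℝ => c * s) atTop atBot := tendsto_id.const_mul_atTop_of_neg h
    have h2 := (Real.tendsto_arctan_atBot.mono_right nhdsWithin_le_nhds).comp h1
    convert h2.const_sub (Real.pi / 2) using 2
    all_goals first | rfl | ring
  · rw [if_neg h.not_gt]
    have h1 : Tendsto (fun s : ℝ => c * s) atTop atTop := tendsto_id.const_mul_atTop h
    have h2 := (Real.tendsto_arctan_atTop.mono_right nhdsWithin_le_nhds).comp h1
    convert h2.const_sub (Real.pi / 2) using 2
    all_goals first | rfl | ring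

theorem tendsto_sum_argAddI {n : ℕ} {α : Fin n → ℝ} {t : ℝ} (ht : ∀ i, α i ≠ t) :
    Tendsto (fun s : ℝ => ∑ i, argAddI ((t - α i) / s⁻¹)) atTop
      (𝓝 ((Finset.univ.filter fun i => t < α i).card * Real.pi)) := by
  have h := tendsto_finsetSum Finset.univ fun i _ =>
    tendsto_argAddI_mul (sub_ne_zero.2 (ht i).symm)
  convert h using 2
  simp only [sub_neg]
  rw [← Finset.sum_filter, Finset.sum_const, nsmul_eq_mul]

/-- With s = 1/y, the phase difference is continuous, starts at π/2 and never meets 0 or π. As s → ∞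
it tends to π times the difference of the two counts, which is therefore 0 or 1. -/
theorem card_filter_lt_of_sin_pos {n : ℕ} {α : Fin (n + 1) → ℝ} {β : Fin n → ℝ} {t : ℝ}
    (hα : ∀ i, α i ≠ t) (hβ : ∀ i, β i ≠ t)
    (h : ∀ y, 0 < y → 0 < Real.sin
      (∑ i, argAddI ((t - α i) / y) - ∑ i, argAddI ((t - β i) / y))) :
    (Finset.univ.filter fun i => t < β i).card ≤ (Finset.univ.filter fun i => t < α i).card ∧
    (Finset.univ.filter fun i => t < α i).card ≤
      (Finset.univ.filter fun i => t < β i).card + 1 := by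
  set φ : ℝ → ℝ := fun s => ∑ i, argAddI ((t - α i) / s⁻¹) - ∑ i, argAddI ((t - β i) / s⁻¹)
    with hφ
  have hcont : Continuous φ := by
    simp only [hφ, div_inv_eq_mul, argAddI]
    fun_prop
  -- At s = 0 every summand is π/2, and there is one more α than β.
  have h0 : φ 0 = Real.pi / 2 := by
    simp [hφ, argAddI]
    ring
  have hne : ∀ s, 0 ≤ s → 0 < Real.sin (φ s) := fun s hs => by
    rcases hs.eq_or_lt with rfl | hs
    · rw [h0, Real.sin_pi_div_two]; exact one_pos
    · exact h s⁻¹ (inv_pos.2 hs)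
  have hpi := Real.pi_pos
  have hmem : ∀ s, 0 ≤ s → φ s ∈ Set.Icc 0 Real.pi := fun s hs => by
    by_contra hout
    have hIVT := intermediate_value_uIcc (a := 0) (b := s) hcont.continuousOn
    rw [h0, Set.uIcc_of_le hs] at hIVT
    rw [Set.mem_Icc, not_and_or, not_le, not_le] at hout
    rcases hout with hlt | hgt
    · obtain ⟨r, hr, hr0⟩ := hIVT (show (0 : ℝ) ∈ _ by
        rw [Set.mem_uIcc]; right; constructor <;> linarith)
      have := hne r hr.1
      rw [hr0, Real.sin_zero] at this
      exact lt_irrefl _ this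
    · obtain ⟨r, hr, hr0⟩ := hIVT (show Real.pi ∈ _ by
        rw [Set.mem_uIcc]; left; constructor <;> linarith)
      have := hne r hr.1
      rw [hr0, Real.sin_pi] at this
      exact lt_irrefl _ this
  have hlim := (tendsto_sum_argAddI hα).sub (tendsto_sum_argAddI hβ)
  have hlimmem := isClosed_Icc.mem_of_tendsto hlim
    ((eventually_ge_atTop (0 : ℝ)).mono fun s hs => hmem s hs)
  rw [← sub_mul] at hlimmem
  obtain ⟨h1, h2⟩ := hlimmem
  have h1' := nonneg_of_mul_nonneg_left h1 hpi
  have h2' := le_of_mul_le_mul_right (h2.trans (one_mul _).ge) hpi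
  constructor
  · exact_mod_cast sub_nonneg.1 h1'
  · have := sub_le_iff_le_add'.1 h2'
    exact_mod_cast this

theorem exists_mem_Ioo_forall_ne {a b : ℝ} (hab : a < b) (s : Set ℝ) (hs : s.Finite) :
    ∃ t ∈ Set.Ioo a b, t ∉ s := by
  obtain ⟨t, ht⟩ := ((Set.Ioo_infinite hab).sdiff hs).nonempty
  exact ⟨t, ht.1, ht.2⟩

theorem interlacing_of_sin_pos {n : ℕ} {α : Fin (n + 1) → ℝ} {β : Fin n → ℝ}
    (hα : Monotone α) (hβ : Monotone β)
    (h : ∀ t y, 0 < y → 0 < Real.sin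
      (∑ i, argAddI ((t - α i) / y) - ∑ i, argAddI ((t - β i) / y))) (i : Fin n) :
    α i.castSucc ≤ β i ∧ β i ≤ α i.succ := by
  have hfin := (Set.finite_range α).union (Set.finite_range β)
  have hcard : ∀ t, t ∉ Set.range α ∪ Set.range β → _ := fun t ht =>
    card_filter_lt_of_sin_pos (fun j hj => ht (Or.inl ⟨j, hj⟩)) (fun j hj => ht (Or.inr ⟨j, hj⟩))
      (h t)
  constructor
  · by_contra! hlt
    -- Above this `t` lie at least n + 1 - i of the α but at most n - 1 - i of the β.
    obtain ⟨t, ⟨h1, h2⟩, ht⟩ := exists_mem_Ioo_forall_ne hlt _ hfin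
    have hA : Finset.Ici i.castSucc ⊆ Finset.univ.filter fun j => t < α j := fun j hj => by
      simpa using h2.trans_le (hα (Finset.mem_Ici.1 hj))
    have hB : (Finset.univ.filter fun j => t < β j) ⊆ Finset.Ioi i := fun j hj => by
      rw [Finset.mem_Ioi]
      by_contra! hji
      exact (h1.trans (Finset.mem_filter.1 hj).2).not_ge (hβ hji)
    have hA' := Finset.card_le_card hA
    have hB' := Finset.card_le_card hB
    have := (hcard t ht).2
    have := i.isLt
    simp only [Fin.card_Ici, Fin.card_Ioi, Fin.val_castSucc] at hA' hB'
    omega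
  · by_contra! hlt
    obtain ⟨t, ⟨h1, h2⟩, ht⟩ := exists_mem_Ioo_forall_ne hlt _ hfin
    have hB : Finset.Ici i ⊆ Finset.univ.filter fun j => t < β j := fun j hj => by
      simpa using h2.trans_le (hβ (Finset.mem_Ici.1 hj))
    have hA : (Finset.univ.filter fun j => t < α j) ⊆ Finset.Ioi i.succ := fun j hj => by
      rw [Finset.mem_Ioi]
      by_contra! hji
      exact (h1.trans (Finset.mem_filter.1 hj).2).not_ge (hα hji)
    have hA' := Finset.card_le_card hA
    have hB' := Finset.card_le_card hB
    have := (hcard t ht).1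
    have := i.isLt
    simp only [Fin.card_Ici, Fin.card_Ioi, Fin.val_succ] at hA' hB'
    omega

/-! ### Preservation of real-rootedness and weak interlacing. -/

theorem RootedIn.splits {I : Set ℝ} {f : ℝ[X]} (hf : RootedIn I f) : f.Splits := by
  refine Splits.of_splits_map (algebraMap ℝ ℂ) (IsAlgClosed.splits _) fun a ha => ?_
  obtain ⟨x, -, hx⟩ := hf.2 a (by simpa [hf.1] using ha)
  exact ⟨x, hx⟩

theorem RootedIn.mono {I J : Set ℝ} {f : ℝ[X]} (hIJ : I ⊆ J) (hf : RootedIn I f) :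
    RootedIn J f :=
  ⟨hf.1, fun z hz => (hf.2 z hz).imp fun _ hx => ⟨hIJ hx.1, hx.2⟩⟩

theorem RootedIn.aeval_ne_zero {I : Set ℝ} {f : ℝ[X]} (hf : RootedIn I f) {z : ℂ}
    (hz : z.im ≠ 0) : aeval z f ≠ 0 := fun h => by
  obtain ⟨x, -, rfl⟩ := hf.2 z h
  exact hz (Complex.ofReal_im x)

theorem realRooted_of_aeval_ne_zero {f : ℝ[X]}
    (hf : ∀ z : ℂ, 0 < z.im → aeval z f ≠ 0) : RealRooted f := by
  refine ⟨fun h => hf Complex.I (by simp) (by simp [h]), fun z hz => ⟨z.re, trivial, ?_⟩⟩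
  have h1 : z.im = 0 := by
    refine le_antisymm (not_lt.1 fun h => hf z h hz) (not_lt.1 fun h => ?_)
    refine hf ((starRingEnd ℂ) z) (by simpa using h) ?_
    rw [aeval_conj, hz, map_zero]
  exact Complex.ext (by simp) (by simp [h1])

theorem aeval_ofReal_eq (f : ℝ[X]) (x : ℝ) : aeval (x : ℂ) f = ((f.eval x : ℝ) : ℂ) := by
  have := aeval_algebraMap_apply ℂ x f
  simpa using this

theorem RootedIn.roots_map {I : Set ℝ} {f : ℝ[X]} (hf : RootedIn I f) :
    ∀ a ∈ (f.map (algebraMap ℝ ℂ)).roots, ∃ x ∈ I, ((x : ℝ) : ℂ) = a := fun a ha =>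
  hf.2 a (by simpa [hf.1] using ha)

theorem map_complex_ne_zero {f : ℝ[X]} (hf : f ≠ 0) : f.map (algebraMap ℝ ℂ) ≠ 0 :=
  (Polynomial.map_ne_zero_iff (algebraMap ℝ ℂ).injective).2 hf

theorem diamondValue_ne_zero_of_im_pos {F : ℂ[X]} {h : ℝ[X]} (hh : RootedIn (Set.Icc (-1) 0) h)
    (hF0 : F ≠ 0) (hF : ∀ a, 0 < a.im → F.eval a ≠ 0) {z : ℂ} (hz : 0 < z.im) :
    diamondValue F (h.map (algebraMap ℝ ℂ)) z ≠ 0 := by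
  refine diamondValue_ne_zero hz.le hF0 (fun a ha => ?_) (map_complex_ne_zero hh.1) hh.roots_map
    (Or.inl ?_)
  · have : ¬ 0 < a.im := fun h => hF a h ((mem_roots hF0).1 ha)
    linarith
  · rw [eval_map_algebraMap]
    exact hh.aeval_ne_zero hz.ne'

theorem RealRooted.diamond {f h : ℝ[X]} (hh : RootedIn (Set.Icc (-1) 0) h) (hf : RealRooted f) :
    RealRooted (f ◇ h) := by
  refine realRooted_of_aeval_ne_zero fun z hz => ?_
  rw [aeval_diamond]
  refine diamondValue_ne_zero_of_im_pos hh (map_complex_ne_zero hf.1) (fun a ha => ?_) hz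
  rw [eval_map_algebraMap]
  exact hf.aeval_ne_zero ha.ne'

theorem add_mul_ne_zero_of_im_pos {u v w : ℂ} (h : 0 < (u * (starRingEnd ℂ) v).im)
    (hw : 0 ≤ w.im) : u + w * v ≠ 0 := fun h0 => by
  rw [eq_neg_of_add_eq_zero_left h0, neg_mul, mul_assoc, Complex.mul_conj, Complex.neg_im,
    Complex.im_mul_ofReal] at h
  have := mul_nonneg hw (Complex.normSq_nonneg v)
  linarith

theorem exists_add_mul_eq_zero_of_im_nonpos {u v : ℂ} (hv : v ≠ 0)
    (h : (u * (starRingEnd ℂ) v).im ≤ 0) : ∃ w : ℂ, 0 ≤ w.im ∧ u + w * v = 0 := by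
  refine ⟨-(u / v), ?_, by field_simp; ring⟩
  rw [div_eq_mul_inv, Complex.inv_def, ← mul_assoc, Complex.neg_im, Complex.im_mul_ofReal]
  have := mul_nonneg (neg_nonneg.2 h) (inv_nonneg.2 (Complex.normSq_nonneg v))
  linarith

/-- The combination of `f` and `g`, scaled by their leading coefficients, with complex
weight `w` on `g`. -/
noncomputable def leadingCombination (f g : ℝ[X]) (w : ℂ) : ℂ[X] :=
  C (f.leadingCoeff : ℂ) * f.map (algebraMap ℝ ℂ) +
    C w * (C (g.leadingCoeff : ℂ) * g.map (algebraMap ℝ ℂ))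

theorem eval_leadingCombination (f g : ℝ[X]) (w z : ℂ) : (leadingCombination f g w).eval z =
    f.leadingCoeff * aeval z f + w * (g.leadingCoeff * aeval z g) := by
  simp [leadingCombination, eval_map_algebraMap]

theorem diamondValue_leadingCombination (f g h : ℝ[X]) (w z : ℂ) :
    diamondValue (leadingCombination f g w) (h.map (algebraMap ℝ ℂ)) z =
      f.leadingCoeff * aeval z (f ◇ h) + w * (g.leadingCoeff * aeval z (g ◇ h)) := by
  simp only [leadingCombination, diamondValue_add, diamondValue_C_mul, aeval_diamond]

theorem eval_leadingCombination_ne_zero {f g : ℝ[X]} {w z : ℂ} (h : 0 < crossIm f g z)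
    (hw : 0 ≤ w.im) : (leadingCombination f g w).eval z ≠ 0 := by
  rw [eval_leadingCombination]
  exact add_mul_ne_zero_of_im_pos h hw

theorem leadingCoeff_diamond_mul_pos {f g h : ℝ[X]} (hf : f ≠ 0) (hg : g ≠ 0) (hh : h ≠ 0) :
    0 < ((f ◇ h).leadingCoeff * (g ◇ h).leadingCoeff) * (f.leadingCoeff * g.leadingCoeff) := by
  have h1 := (natDegree_diamond_and_leadingCoeff_mul_pos f h hf hh).2
  have h2 := (natDegree_diamond_and_leadingCoeff_mul_pos g h hg hh).2
  refine pos_of_mul_pos_left (b := h.leadingCoeff ^ 2) ?_ (sq_nonneg _)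
  convert mul_pos h1 h2 using 1
  ring

/-- If positivity failed at z, some w with Im w ≥ 0 would make the combination of f ◇ h and g ◇ h
vanish there, although the same combination of f and g has no zero in the upper half-plane. -/
theorem crossIm_diamond_pos {f g h : ℝ[X]} (hh : RootedIn (Set.Icc (-1) 0) h) (hf : f ≠ 0)
    (hg : RealRooted g) (hfg : ∀ z : ℂ, 0 < z.im → 0 < crossIm f g z) {z : ℂ} (hz : 0 < z.im) :
    0 < crossIm (f ◇ h) (g ◇ h) z := by
  have hcross : ∀ a b : ℝ, ((a * aeval z (f ◇ h)) * (starRingEnd ℂ) (b * aeval z (g ◇ h))).im =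
      a * b * (aeval z (f ◇ h) * (starRingEnd ℂ) (aeval z (g ◇ h))).im := fun a b => by
    rw [map_mul, Complex.conj_ofReal, mul_mul_mul_comm, ← Complex.ofReal_mul,
      Complex.im_ofReal_mul]
  by_contra hneg
  have hlc := leadingCoeff_diamond_mul_pos hf hg.1 hh.1
  have hle : ((f.leadingCoeff * aeval z (f ◇ h)) *
      (starRingEnd ℂ) (g.leadingCoeff * aeval z (g ◇ h))).im ≤ 0 := by
    rw [crossIm, hcross, not_lt] at hneg
    rw [hcross]
    -- Normalising by the leading coefficients of f, g or by those of the diamond products gives the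
    -- same sign.
    by_contra! hpos
    rcases pos_and_pos_or_neg_and_neg_of_mul_pos hlc with ⟨h1, h2⟩ | ⟨h1, h2⟩ <;> nlinarith
  have hv : (g.leadingCoeff : ℂ) * aeval z (g ◇ h) ≠ 0 :=
    mul_ne_zero (by exact_mod_cast leadingCoeff_ne_zero.2 hg.1)
      ((RealRooted.diamond hh hg).aeval_ne_zero hz.ne')
  obtain ⟨w, hw, h0⟩ := exists_add_mul_eq_zero_of_im_nonpos hv hle
  rw [← diamondValue_leadingCombination] at h0
  have hne : ∀ a : ℂ, 0 < a.im → (leadingCombination f g w).eval a ≠ 0 := fun a ha =>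
    eval_leadingCombination_ne_zero (hfg a ha) hw
  exact diamondValue_ne_zero_of_im_pos hh
    (fun hF => hne Complex.I (by simp) (by simp [hF])) hne hz h0

theorem exists_monotone_enumeration (s : Multiset ℝ) {n : ℕ} (hs : s.card = n) :
    ∃ α : Fin n → ℝ, Monotone α ∧ s = Finset.univ.val.map α := by
  subst hs
  rw [← Multiset.length_sort (s := s) (r := (· ≤ ·))]
  refine ⟨(s.sort (· ≤ ·)).get, ?_, ?_⟩
  · exact (Multiset.pairwise_sort s (· ≤ ·)).sortedLE.monotone_get
  · rw [Fin.univ_val_map, List.ofFn_get, Multiset.sort_eq]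

theorem Interlaces.crossIm_pos {f g : ℝ[X]} (hgf : g ⪯ᵢ f) {z : ℂ} (hz : 0 < z.im) :
    0 < crossIm f g z := by
  obtain ⟨hg, hf, -, α, β, -, -, hα, hβ, h⟩ := hgf
  exact crossIm_pos_of_interlacing hf.splits hf.1 hg.splits hg.1 hα hβ h hz

theorem interlaces_of_crossIm_pos {f g : ℝ[X]} (hf : RealRooted f) (hg : RealRooted g)
    (hdeg : f.natDegree = g.natDegree + 1) (h : ∀ z : ℂ, 0 < z.im → 0 < crossIm f g z) :
    g ⪯ᵢ f := by
  obtain ⟨α, hαm, hα⟩ := exists_monotone_enumeration f.roots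
    (hf.splits.natDegree_eq_card_roots.symm.trans hdeg)
  obtain ⟨β, hβm, hβ⟩ := exists_monotone_enumeration g.roots
    hg.splits.natDegree_eq_card_roots.symm
  refine ⟨hg, hf, hdeg, α, β, hαm, hβm, hα, hβ, interlacing_of_sin_pos hαm hβm fun t y hy => ?_⟩
  rw [← rootPhase_eq_sum hα, ← rootPhase_eq_sum hβ,
    ← crossIm_pos_iff hf.splits hf.1 hg.splits hg.1 t hy]
  exact h _ (by simpa using hy)

theorem Interlaces.diamond {f g h : ℝ[X]} (hh : RootedIn (Set.Icc (-1) 0) h) (hgf : g ⪯ᵢ f) :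
    (g ◇ h) ⪯ᵢ (f ◇ h) := by
  obtain ⟨hg, hf, hdeg, -⟩ := id hgf
  refine interlaces_of_crossIm_pos (RealRooted.diamond hh hf) (RealRooted.diamond hh hg) ?_
    fun z hz => crossIm_diamond_pos hh hf.1 hg (fun a ha => hgf.crossIm_pos ha) hz
  rw [(natDegree_diamond_and_leadingCoeff_mul_pos f h hf.1 hh.1).1,
    (natDegree_diamond_and_leadingCoeff_mul_pos g h hg.1 hh.1).1, hdeg]
  ring

/-! ### Strict interlacing and simple zeros. -/

theorem StrictlyInterlaces.interlaces {f g : ℝ[X]} (h : g ≺ᵢ f) : g ⪯ᵢ f := by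
  obtain ⟨hg, hf, hdeg, α, β, h1, h2, h3, h4, h5⟩ := h
  exact ⟨hg, hf, hdeg, α, β, h1, h2, h3, h4, fun i => ⟨(h5 i).1.le, (h5 i).2.le⟩⟩

theorem StrictlyInterlaces.eval_ne_zero {f g : ℝ[X]} (h : g ≺ᵢ f) {x : ℝ} (hf : f.eval x = 0) :
    g.eval x ≠ 0 := fun hg => by
  obtain ⟨hg', hf', -, α, β, hαm, -, hα, hβ, h5⟩ := h
  have h1 := (mem_roots hf'.1).2 hf
  have h2 := (mem_roots hg'.1).2 hg
  rw [hα, Multiset.mem_map] at h1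
  rw [hβ, Multiset.mem_map] at h2
  obtain ⟨i, -, hi⟩ := h1
  obtain ⟨j, -, hj⟩ := h2
  rcases le_or_gt i j.castSucc with hij | hij
  · have := hαm hij
    linarith [(h5 j).1]
  · have := hαm (Fin.castSucc_lt_iff_succ_le.1 hij)
    linarith [(h5 j).2]

theorem Interlaces.strictlyInterlaces {f g : ℝ[X]} (h : g ⪯ᵢ f)
    (hne : ∀ x : ℝ, f.eval x = 0 → g.eval x ≠ 0) : g ≺ᵢ f := by
  obtain ⟨hg, hf, hdeg, α, β, h1, h2, h3, h4, h5⟩ := h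
  have hα : ∀ i, f.eval (α i) = 0 := fun i => (mem_roots hf.1).1 (by
    rw [h3]; exact Multiset.mem_map_of_mem _ (Finset.mem_univ_val _))
  have hβ : ∀ i, g.eval (β i) = 0 := fun i => (mem_roots hg.1).1 (by
    rw [h4]; exact Multiset.mem_map_of_mem _ (Finset.mem_univ_val _))
  exact ⟨hg, hf, hdeg, α, β, h1, h2, h3, h4, fun i =>
    ⟨(h5 i).1.lt_of_ne fun h => hne _ (hα i.castSucc) (h ▸ hβ i),
      (h5 i).2.lt_of_ne fun h => hne _ (hα i.succ) (h ▸ hβ i)⟩⟩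

theorem simpleRooted_iff_nodup_roots {f : ℝ[X]} (hf : RealRooted f) :
    SimpleRooted f ↔ f.roots.Nodup := by
  have hmult := fun x : ℝ => one_lt_rootMultiplicity_iff_isRoot (t := x) hf.1
  rw [Multiset.nodup_iff_count_le_one]
  constructor
  · intro h x
    rw [count_roots]
    by_contra! hlt
    obtain ⟨h1, h2⟩ := (hmult x).1 hlt
    refine h x ?_ ?_
    · rw [aeval_ofReal_eq, h1.eq_zero, Complex.ofReal_zero]
    · rw [aeval_ofReal_eq, h2.eq_zero, Complex.ofReal_zero]
  · intro h z hz hz'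
    obtain ⟨x, -, rfl⟩ := hf.2 z hz
    rw [aeval_ofReal_eq, Complex.ofReal_eq_zero] at hz hz'
    have := (hmult x).2 ⟨hz, hz'⟩
    have := h x
    rw [count_roots] at this
    omega

theorem StrictlyInterlaces.simpleRooted {f g : ℝ[X]} (h : g ≺ᵢ f) : SimpleRooted f := by
  obtain ⟨hg, hf, -, α, β, -, -, hα, -, h5⟩ := h
  rw [simpleRooted_iff_nodup_roots hf, hα]
  refine Finset.univ.nodup.map (StrictMono.injective (Fin.strictMono_iff_lt_succ.2 fun i => ?_))
  exact (h5 i).1.trans (h5 i).2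

theorem StrictlyInterlaces.diamond {f g h : ℝ[X]} (hh : RootedIn (Set.Ioo (-1) 0) h)
    (hs : SimpleRooted h) (hgf : g ≺ᵢ f) : (g ◇ h) ≺ᵢ (f ◇ h) := by
  have hh' := hh.mono Set.Ioo_subset_Icc_self
  refine (hgf.interlaces.diamond hh').strictlyInterlaces fun x hfx hgx => ?_
  have hf := hgf.2.1
  have h0 := diamondValue_leadingCombination f g h Complex.I x
  rw [aeval_ofReal_eq, aeval_ofReal_eq, hfx, hgx] at h0
  simp only [Complex.ofReal_zero, mul_zero, add_zero] at h0
  have hl := leadingCoeff_ne_zero.2 hf.1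
  have hcoeff : (leadingCombination f g Complex.I).coeff f.natDegree ≠ 0 := by
    have hg0 : g.coeff f.natDegree = 0 := coeff_eq_zero_of_natDegree_lt (by have := hgf.2.2.1; omega)
    simpa [leadingCombination, hg0] using hf.1
  have hF0 : leadingCombination f g Complex.I ≠ 0 := fun h => hcoeff (by simp [h])
  refine diamondValue_ne_zero (by simp) hF0 (fun a ha => ?_) (map_complex_ne_zero hh.1)
    hh'.roots_map ?_ h0
  · have hroot : (leadingCombination f g Complex.I).eval a = 0 := (mem_roots hF0).1 ha
    rw [Complex.ofReal_im]
    by_contra! hnonneg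
    -- A real zero of f + i g (up to real scalings) would be a common zero of f and g.
    rcases hnonneg.eq_or_lt with him | hpos
    · obtain ⟨r, rfl⟩ : ∃ r : ℝ, (r : ℂ) = a := ⟨a.re, Complex.ext (by simp) (by simp [him])⟩
      rw [eval_leadingCombination, aeval_ofReal_eq, aeval_ofReal_eq] at hroot
      have hre := congrArg Complex.re hroot
      have him := congrArg Complex.im hroot
      simp [hf.1, hgf.1.1] at hre him
      exact hgf.eval_ne_zero hre him
    · exact eval_leadingCombination_ne_zero (hgf.interlaces.crossIm_pos hpos) (by simp) hroot
  -- A zero x of h is simple and differs from -1 and 0, so h'(x) x (x+1) ≠ 0.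
  · rw [or_iff_not_imp_left, not_not, eval_map_algebraMap, derivative_map, eval_map_algebraMap]
    intro hx
    refine ⟨?_, mul_ne_zero (hs _ hx) ?_⟩
    · have := le_natDegree_of_ne_zero hcoeff
      have := hgf.2.2.1
      omega
    · obtain ⟨y, ⟨h1, h2⟩, hy⟩ := hh.2 _ hx
      have hyx : y = x := by exact_mod_cast hy
      subst hyx
      have : y * (y + 1) ≠ 0 := mul_ne_zero h2.ne (by linarith)
      exact_mod_cast this

/-- Midpoints of consecutive zeros serve. This reduces simplicity of f ◇ h to strict interlacing,
except for constant f. -/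
theorem exists_strictlyInterlaces {f : ℝ[X]} (hf : RealRooted f) (hs : SimpleRooted f)
    (hdeg : f.natDegree ≠ 0) : ∃ g, g ≺ᵢ f := by
  obtain ⟨n, hn⟩ := Nat.exists_eq_succ_of_ne_zero hdeg
  obtain ⟨α, hαm, hα⟩ := exists_monotone_enumeration f.roots
    (hf.splits.natDegree_eq_card_roots.symm.trans hn)
  have hnodup := (simpleRooted_iff_nodup_roots hf).1 hs
  rw [hα] at hnodup
  have hαs : StrictMono α := hαm.strictMono_of_injective fun i j hij =>
    Multiset.inj_on_of_nodup_map hnodup i (Finset.mem_univ_val _) j (Finset.mem_univ_val _) hij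
  let β : Fin n → ℝ := fun i => (α i.castSucc + α i.succ) / 2
  have hβ : ∀ i, α i.castSucc < β i ∧ β i < α i.succ := fun i => by
    have := hαs (Fin.castSucc_lt_succ (i := i))
    constructor <;> simp only [β] <;> linarith
  have hβm : Monotone β := fun i j hij => by
    have h1 := hαm (Fin.castSucc_le_castSucc_iff.2 hij)
    have h2 := hαm (Fin.succ_le_succ_iff.2 hij)
    simp only [β]
    linarith
  let s : Multiset ℝ := Finset.univ.val.map β
  let g : ℝ[X] := (s.map fun a => X - C a).prod
  have hroots : g.roots = s := roots_multiset_prod_X_sub_C s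
  have hgdeg : g.natDegree = n := by
    rw [natDegree_multiset_prod_X_sub_C_eq_card]
    simp [s]
  have hg : RealRooted g := by
    refine realRooted_of_aeval_ne_zero fun z hz h0 => ?_
    simp only [g, map_multiset_prod, Multiset.map_map, Multiset.prod_eq_zero_iff,
      Multiset.mem_map, Function.comp_apply, map_sub, aeval_X, aeval_C] at h0
    obtain ⟨a, -, ha⟩ := h0
    rw [sub_eq_zero.1 ha] at hz
    simp at hz
  clear_value g
  subst hgdeg
  exact ⟨g, hg, hf, hn, α, β, hαm, hβm, hα, hroots, hβ⟩

theorem diamond_C (c : ℝ) (h : ℝ[X]) : C c ◇ h = C c * h := by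
  simp [diamond]

theorem SimpleRooted.diamond {f h : ℝ[X]} (hh : RootedIn (Set.Ioo (-1) 0) h)
    (hs : SimpleRooted h) (hf : RealRooted f) (hfs : SimpleRooted f) : SimpleRooted (f ◇ h) := by
  by_cases hdeg : f.natDegree = 0
  · obtain ⟨c, rfl⟩ := natDegree_eq_zero.1 hdeg
    have hc : c ≠ 0 := fun h => hf.1 (by rw [h, C_0])
    intro z hz
    rw [diamond_C, map_mul, aeval_C] at hz
    rw [diamond_C, derivative_C_mul, map_mul, aeval_C]
    have hc' : algebraMap ℝ ℂ c ≠ 0 := by simpa using hc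
    exact mul_ne_zero hc' (hs z ((mul_eq_zero.1 hz).resolve_left hc'))
  · obtain ⟨g, hg⟩ := exists_strictlyInterlaces hf hfs hdeg
    exact (hg.diamond hh hs).simpleRooted

theorem mainTheorem1 (h f : ℝ[X]) (hh : RootedIn (Set.Icc (-1) 0) h) (hf : RealRooted f) :
    (RealRooted (f ◇ h) ∧ ∀ g : ℝ[X], g ⪯ᵢ f → (g ◇ h) ⪯ᵢ (f ◇ h)) ∧
    (RootedIn (Set.Ioo (-1) 0) h → SimpleRooted h → SimpleRooted f →
      SimpleRooted (f ◇ h) ∧ ∀ g : ℝ[X], g ≺ᵢ f → (g ◇ h) ≺ᵢ (f ◇ h)) :=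
  ⟨⟨hf.diamond hh, fun _ hg => hg.diamond hh⟩, fun hh' hs hfs =>
    ⟨SimpleRooted.diamond hh' hs hf hfs, fun _ hg => hg.diamond hh' hs⟩⟩
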